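/- Let $P$ be a smooth $N$-dimensional manifold with a general $n$-symplectic structure, that is, an $\mathbb R^n$-valued smooth 2-form $\hat\omega=\sum_\alpha\omega^\alpha\otimes\hat r_\alpha$ ($(\hat r_\alpha)$ the standard basis of $\mathbb R^n$) such that $d\omega^\alpha=0$ for all $\alpha$ and, for every tangent vector $X$, $X\lrcorner\,\omega^\alpha=0$ for all $\alpha$ if and only if $X=0$. Round brackets around indices denote symmetrization, $T^{(\alpha_1\dots\alpha_m)}=\frac1{m!}\sum_{\sigma\in S_m}T^{\alpha_{\sigma(1)}\dots\alpha_{\sigma(m)}}$. For $p\ge 1$ let $SHF^p$ be the real vector space of smooth functions $\hat f=(\hat f^{\alpha_1\dots\alpha_p})$ on $P$ with values in the symmetric tensors $\otimes_s^p\mathbb R^n$ for which there are smooth vector fields $X_{\hat f}^{\alpha_1\dots\alpha_{p-1}}$ on $P$ with $$d\hat f^{\alpha_1\dots\alpha_p}=-p!\,X_{\hat f}^{(\alpha_1\dots\alpha_{p-1}}\lrcorner\,\omega^{\alpha_p)},$$ and let $SHF=\bigoplus_{p\ge1}SHF^p$. Theorem. (i) For $\hat f\in SHF^p$ and $\hat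 g\in SHF^q$ the symmetrized tensor product $(\hat f\otimes_s\hat g)^{\alpha_1\dots\alpha_{p+q}}=\hat f^{(\alpha_1\dots\alpha_p}\hat g^{\alpha_{p+1}\dots\alpha_{p+q})}$ lies in $SHF^{p+q}$. (ii) For $\hat f\in SHF^p$ and $\hat g\in SHF^q$ the bracket $$\{\hat f,\hat g\}^{\alpha_1\dots\alpha_{p+q-1}}=p!\,X_{\hat f}^{(\alpha_1\dots\alpha_{p-1}}\bigl(\hat g^{\alpha_p\dots\alpha_{p+q-1})}\bigr)$$ does not depend on the choice of the vector fields $X_{\hat f}^{\alpha_1\dots\alpha_{p-1}}$ satisfying the above equation for $\hat f$, and lies in $SHF^{p+q-1}$. (iii) The operations $\otimes_s$ and $\{\ ,\ \}$ extend to $\mathbb R$-bilinear operations on $SHF$, and these make $SHF$ a (not necessarily unital) Poisson algebra: $(SHF,\otimes_s)$ is a commutative associative algebra, $(SHF,\{\ ,\ \})$ is a Lie algebra, and $\{\hat f,\hat g\otimes_s\hat h\}=\{\hat f,\hat g\}\otimes_s\hat h+\hat g\otimes_s\{\hat f,\hat h\}$ for all $\hat f,\hat g,\hat h\in SHF$.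 -/

import Mathlib

open scoped Manifold ContDiff

noncomputable section

namespace NSymplectic

/-- The set of multi-indices `α₁ … α_m` with entries in `{1, …, n}`. -/
abbrev MultiIndex (n m : ℕ) : Type := Fin m → Fin n

/-- Round brackets around indices: `T^{(α₁ … α_m)} = (1 / m!) ∑_σ T^{α_{σ 1} … α_{σ m}}`. -/
def symmetrize {V : Type*} [AddCommGroup V] [Module ℝ V] {n m : ℕ}
    (T : MultiIndex n m → V) (α : MultiIndex n m) : V :=
  ((m.factorial : ℝ)⁻¹) • ∑ σ : Equiv.Perm (Fin m), T (α ∘ σ)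

/-- The family `T^{α₁ … α_m}` is symmetric in its upper indices. -/
def IsSymm {V : Type*} {n m : ℕ} (T : MultiIndex n m → V) : Prop :=
  ∀ (σ : Equiv.Perm (Fin m)) (α : MultiIndex n m), T (α ∘ σ) = T α

section Manifold

variable {N : ℕ} {P : Type*} [TopologicalSpace P] [ChartedSpace (EuclideanSpace ℝ (Fin N)) P]

/-- The representation of a `k`-form `η` on `P` in the chart `φ` at `x₀`: the pullback of `η`
along `φ⁻¹`. It is meaningful on the (open) target of the chart. -/
def formInChart {k : ℕ} (η : (x : P) → (TangentSpace (𝓡 N) x) [⋀^Fin k]→L[ℝ] ℝ) (x₀ : P)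
    (y : EuclideanSpace ℝ (Fin N)) : (EuclideanSpace ℝ (Fin N)) [⋀^Fin k]→L[ℝ] ℝ :=
  (η ((extChartAt (𝓡 N) x₀).symm y)).compContinuousLinearMap
    (mfderiv 𝓘(ℝ, EuclideanSpace ℝ (Fin N)) (𝓡 N) (extChartAt (𝓡 N) x₀).symm y)

/-- A differential form on `P` is smooth if all its chart representations are. -/
def IsSmoothForm {k : ℕ} (η : (x : P) → (TangentSpace (𝓡 N) x) [⋀^Fin k]→L[ℝ] ℝ) : Prop :=
  ∀ x₀ : P, ContDiffOn ℝ ∞ (formInChart η x₀) (extChartAt (𝓡 N) x₀).target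

/-- A differential form on `P` is closed if the exterior derivative of each of its chart
representations vanishes. -/
def IsClosedForm {k : ℕ} (η : (x : P) → (TangentSpace (𝓡 N) x) [⋀^Fin k]→L[ℝ] ℝ) : Prop :=
  ∀ x₀ : P, ∀ y ∈ (extChartAt (𝓡 N) x₀).target, extDeriv (formInChart η x₀) y = 0

end Manifold

/-- A general `n`-symplectic (polysymplectic) structure on the `N`-dimensional manifold `P`: an
`ℝⁿ`-valued smooth 2-form `ω̂ = ω^α ⊗ r_α`, given by its components `ω^α`, that is closed and
non-degenerate. -/
structure GeneralNSymplecticStructure (N n : ℕ) (P : Type*) [TopologicalSpace P]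
    [ChartedSpace (EuclideanSpace ℝ (Fin N)) P] where
  /-- The components `ω^α`. -/
  form : Fin n → (x : P) → (TangentSpace (𝓡 N) x) [⋀^Fin 2]→L[ℝ] ℝ
  smooth : ∀ α, IsSmoothForm (form α)
  closed : ∀ α, IsClosedForm (form α)
  nondegenerate : ∀ (x : P) (v : TangentSpace (𝓡 N) x),
    (∀ (α : Fin n) (w : TangentSpace (𝓡 N) x), form α x ![v, w] = 0) ↔ v = 0

variable {N n : ℕ} {P : Type*} [TopologicalSpace P] [ChartedSpace (EuclideanSpace ℝ (Fin N)) P]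

variable (N n P) in
/-- Families `f^{α₁ … α_m}` of smooth real functions on `P`: the components, in the standard basis,
of smooth functions on `P` with values in the `m`-th tensor power of `ℝⁿ`. -/
abbrev TensorFunction (m : ℕ) : Type _ := MultiIndex n m → C^∞⟮𝓡 N, P; ℝ⟯

variable [IsManifold (𝓡 N) ∞ P]

variable (N n P) in
/-- Families `X^{α₁ … α_m}` of smooth vector fields on `P`. -/
abbrev TensorVectorField (m : ℕ) : Type _ :=
  MultiIndex n m →
    Cₛ^∞⟮𝓡 N; EuclideanSpace ℝ (Fin N), (TangentSpace (𝓡 N) : P → Type _)⟯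

/-- `X` is a set of Hamiltonian vector fields for the family `f` of rank `k + 1`:
`d f^{α₁ … α_{k+1}} = - (k+1)! X^{(α₁ … α_k} ⌟ ω^{α_{k+1})}`.
Only the symmetric part of `X` in its upper indices enters, so `X` need not be taken symmetric:
if `X` satisfies the equation, then so does its symmetrization. -/
def IsHamiltonianFor (Ω : GeneralNSymplecticStructure N n P) {k : ℕ}
    (f : TensorFunction N n P (k + 1)) (X : TensorVectorField N n P k) : Prop :=
  ∀ (α : MultiIndex n (k + 1)) (x : P) (w : TangentSpace (𝓡 N) x),
    mvfderiv (𝓡 N) (f α) x w =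
      -((k + 1).factorial : ℝ) *
        symmetrize (fun β : MultiIndex n (k + 1) =>
          Ω.form (β (Fin.last k)) x ![X (fun i => β i.castSucc) x, w]) α

theorem symmetrize_add_apply {n m : ℕ} (S T : MultiIndex n m → ℝ) (α : MultiIndex n m) :
    symmetrize S α + symmetrize T α = symmetrize (fun β => S β + T β) α := by
  simp [symmetrize, Finset.sum_add_distrib, mul_add]

theorem form_add_left {E : Type*} [AddCommGroup E] [Module ℝ E] [TopologicalSpace E]
    (η : E [⋀^Fin 2]→L[ℝ] ℝ) (u v w : E) : η ![u + v, w] = η ![u, w] + η ![v, w] := by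
  exact η.map_vecCons_add ![w] u v

theorem form_smul_left {E : Type*} [AddCommGroup E] [Module ℝ E] [TopologicalSpace E]
    (η : E [⋀^Fin 2]→L[ℝ] ℝ) (c : ℝ) (v w : E) : η ![c • v, w] = c * η ![v, w] := by
  exact η.map_vecCons_smul ![w] c v

theorem form_zero_left {E : Type*} [AddCommGroup E] [Module ℝ E] [TopologicalSpace E]
    (η : E [⋀^Fin 2]→L[ℝ] ℝ) (w : E) : η ![0, w] = 0 :=
  η.map_coord_zero 0 rfl

/-- The space of symmetric Hamiltonian functions of rank `k + 1`. Indexing by `k = rank - 1` builds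
in the restriction to ranks `≥ 1`. -/
def SHF (Ω : GeneralNSymplecticStructure N n P) (k : ℕ) :
    Submodule ℝ (TensorFunction N n P (k + 1)) where
  carrier := {f | IsSymm f ∧ ∃ X : TensorVectorField N n P k, IsHamiltonianFor Ω f X}
  add_mem' := by
    rintro f g ⟨hf, X, hfX⟩ ⟨hg, Y, hgY⟩
    refine ⟨fun σ α => by simp [hf σ α, hg σ α], X + Y, ?_⟩
    intro α x w
    have h : mvfderiv (𝓡 N) (⇑((f + g) α)) x =
        mvfderiv (𝓡 N) (f α) x + mvfderiv (𝓡 N) (g α) x :=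
      mvfderiv_add ((f α).contMDiff.mdifferentiable (by simp) x)
        ((g α).contMDiff.mdifferentiable (by simp) x)
    rw [h, add_apply, hfX, hgY, ← mul_add, symmetrize_add_apply]
    congr 2
    funext β
    exact (form_add_left _ _ _ _).symm
  zero_mem' := by
    refine ⟨fun σ α => rfl, 0, ?_⟩
    intro α x w
    have h : mvfderiv (𝓡 N) (⇑((0 : TensorFunction N n P (k + 1)) α)) x = 0 :=
      mvfderiv_zero
    rw [h, zero_apply]
    have h0 : (fun β : MultiIndex n (k + 1) => Ω.form (β (Fin.last k)) x
        ![(0 : TensorVectorField N n P k) (fun i => β i.castSucc) x, w]) = fun _ => 0 := by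
      funext β
      exact form_zero_left _ _
    rw [h0]
    simp [symmetrize]
  smul_mem' := by
    rintro c f ⟨hf, X, hfX⟩
    refine ⟨fun σ α => by simp [hf σ α], c • X, ?_⟩
    intro α x w
    have h : mvfderiv (𝓡 N) (⇑((c • f) α)) x = c • mvfderiv (𝓡 N) (f α) x := by
      have h1 := const_smul_mfderiv (I := 𝓡 N)
        ((f α).contMDiff.mdifferentiable (by simp) x) c
      ext v
      exact congrArg (fun L => L v) h1
    have h2 : (fun β : MultiIndex n (k + 1) => Ω.form (β (Fin.last k)) x
        ![(c • X) (fun i => β i.castSucc) x, w]) = fun β => c * Ω.form (β (Fin.last k)) x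
        ![X (fun i => β i.castSucc) x, w] := by
      funext β
      exact form_smul_left _ _ _ _
    rw [h, smul_apply, hfX, h2]
    simp only [symmetrize, smul_eq_mul, ← Finset.mul_sum]
    ring

/-- The symmetrized tensor product:
`(f ⊗ₛ g)^{α₁ … α_{p+q}} = f^{(α₁ … α_p} g^{α_{p+1} … α_{p+q})}`. -/
def symProduct {p q : ℕ} (f : TensorFunction N n P p) (g : TensorFunction N n P q) :
    TensorFunction N n P (p + q) :=
  symmetrize fun β : MultiIndex n (p + q) =>
    f (fun i => β (Fin.castAdd q i)) * g (fun j => β (Fin.natAdd p j))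

/-- The components of the bracket of `f` (of rank `k + 1`, with Hamiltonian vector fields `X`) and
`g` (of rank `l + 1`), at the point `x`:
`(k+1)! X^{(α₁ … α_k} (g^{α_{k+1} … α_{k+l+1})})`. -/
def bracketComponent {k l : ℕ} (X : TensorVectorField N n P k) (g : TensorFunction N n P (l + 1))
    (α : MultiIndex n (k + l + 1)) (x : P) : ℝ :=
  ((k + 1).factorial : ℝ) *
    symmetrize (fun β : MultiIndex n (k + (l + 1)) =>
      mvfderiv (𝓡 N) (g (fun j => β (Fin.natAdd k j))) x
        (X (fun i => β (Fin.castAdd (l + 1) i)) x)) α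

/-- `SHF`, the direct sum over all ranks `p = k + 1 ≥ 1` of the spaces of symmetric Hamiltonian
functions of rank `p`. -/
abbrev TotalSHF (Ω : GeneralNSymplecticStructure N n P) : Type _ :=
  DirectSum ℕ fun k => SHF Ω k

/-- A (not necessarily unital) real Poisson algebra: a commutative associative product together
with a Lie bracket that acts by derivations of the product. -/
structure IsPoissonAlgebra {A : Type*} [AddCommGroup A] [Module ℝ A]
    (mul br : A →ₗ[ℝ] A →ₗ[ℝ] A) : Prop where
  mul_comm : ∀ a b, mul a b = mul b a
  mul_assoc : ∀ a b c, mul (mul a b) c = mul a (mul b c)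
  bracket_self : ∀ a, br a a = 0
  bracket_antisymm : ∀ a b, br a b = -br b a
  jacobi : ∀ a b c, br a (br b c) + br b (br c a) + br c (br a b) = 0
  leibniz : ∀ a b c, br a (mul b c) = mul (br a b) c + mul b (br a c)

end NSymplectic

end

/-!
A symmetric family `f^{α₁ … α_p}` is determined by the homogeneous polynomial
`f_ξ = ∑ f^{α₁ … α_p} ξ_{α₁} … ξ_{α_p}` in a covector `ξ`. Contracting with `ξ` turns the equation
for the Hamiltonian vector fields into `d f_ξ = -p! X_ξ ⌟ ω_ξ`, where `ω_ξ = ∑ ξ_γ ω^γ` is a closed,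
possibly degenerate, scalar 2-form. It also turns `⊗ₛ` into the pointwise product of functions and
the bracket into `p! X_ξ(g_ξ)`, the classical bracket of Hamiltonian functions of a presymplectic
form. So every identity to be proved reduces to the classical one for `ω_ξ`, for all `ξ`.
An element of `SHF` of mixed rank is also determined by its contractions, because replacing `ξ` by
`t ξ` multiplies the part of rank `p` by `t ^ p`.
-/

noncomputable section

namespace NSymplectic

section VectorSpace

open VectorField Filter Topology

section Algebra

variable {R M F : Type*} [Ring R] [AddCommGroup M] [Module R M] [TopologicalSpace M]
  [AddCommGroup F] [Module R F] [TopologicalSpace F]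

theorem form_swap (η : M [⋀^Fin 2]→L[R] F) (v w : M) : η ![v, w] = -η ![w, v] := by
  have hswap : ![w, v] ∘ Equiv.swap (0 : Fin 2) 1 = ![v, w] := by
    ext i
    fin_cases i <;> simp
  rw [← hswap]
  exact η.map_swap ![w, v] zero_ne_one

theorem form_sub_left (η : M [⋀^Fin 2]→L[R] F) (u v w : M) :
    η ![u - v, w] = η ![u, w] - η ![v, w] := by
  have hadd := η.map_vecCons_add ![w] (u - v) v
  rw [sub_add_cancel] at hadd
  exact eq_sub_of_add_eq hadd.symm

end Algebra

variable {𝕜 F : Type*} [NontriviallyNormedField 𝕜] {E : Type*} [NormedAddCommGroup E]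
  [NormedSpace 𝕜 E] [NormedAddCommGroup F] [NormedSpace 𝕜 F] {ζ : E → E [⋀^Fin 2]→L[𝕜] F}
  {X Y Z : E → E} {y : E}

theorem fderiv_form_apply (hζ : DifferentiableAt 𝕜 ζ y) (hX : DifferentiableAt 𝕜 X y)
    (hY : DifferentiableAt 𝕜 Y y) (u : E) :
    fderiv 𝕜 (fun z => ζ z ![X z, Y z]) y u = fderiv 𝕜 ζ y u ![X y, Y y] +
      ζ y ![fderiv 𝕜 X y u, Y y] + ζ y ![X y, fderiv 𝕜 Y y u] := by
  have hXY : ∀ i, DifferentiableAt 𝕜 ((![X, Y] : Fin 2 → E → E) i) y :=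
    Fin.forall_fin_two.2 ⟨hX, hY⟩
  have hvec : ∀ z, (fun i => (![X, Y] : Fin 2 → E → E) i z) = ![X z, Y z] := fun z => by
    ext i
    fin_cases i <;> rfl
  have hupdate : ∀ a b c : E, Function.update ![a, b] 0 c = ![c, b] ∧
      Function.update ![a, b] 1 c = ![a, c] := fun a b c => by
    constructor <;> ext i <;> fin_cases i <;> simp
  have hfderiv := fderiv_continuousAlternatingMap_apply_apply hζ hXY u
  simp only [hvec] at hfderiv
  simp [hfderiv, Fin.sum_univ_two, hupdate, add_assoc]

theorem extDeriv_apply_three (hζ : DifferentiableAt 𝕜 ζ y) (u v w : E) :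
    extDeriv ζ y ![u, v, w] =
      fderiv 𝕜 ζ y u ![v, w] - fderiv 𝕜 ζ y v ![u, w] + fderiv 𝕜 ζ y w ![u, v] := by
  have hremove : (0 : Fin 3).removeNth ![u, v, w] = ![v, w] ∧
      (1 : Fin 3).removeNth ![u, v, w] = ![u, w] ∧ (2 : Fin 3).removeNth ![u, v, w] = ![u, v] := by
    refine ⟨?_, ?_, ?_⟩ <;> ext i <;> fin_cases i <;> rfl
  rw [extDeriv_apply hζ, Fin.sum_univ_three, hremove.1, hremove.2.1, hremove.2.2]
  simp [fderiv_continuousAlternatingMap_apply_const_apply hζ, sub_eq_add_neg]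

theorem extDeriv_apply_three_vectorFields (hζ : DifferentiableAt 𝕜 ζ y)
    (hX : DifferentiableAt 𝕜 X y) (hY : DifferentiableAt 𝕜 Y y) (hZ : DifferentiableAt 𝕜 Z y) :
    extDeriv ζ y ![X y, Y y, Z y] =
      fderiv 𝕜 (fun z => ζ z ![Y z, Z z]) y (X y) - fderiv 𝕜 (fun z => ζ z ![X z, Z z]) y (Y y) +
        fderiv 𝕜 (fun z => ζ z ![X z, Y z]) y (Z y) - ζ y ![lieBracket 𝕜 X Y y, Z y] +
        ζ y ![lieBracket 𝕜 X Z y, Y y] - ζ y ![lieBracket 𝕜 Y Z y, X y] := by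
  rw [extDeriv_apply_three hζ, fderiv_form_apply hζ hY hZ, fderiv_form_apply hζ hX hZ,
    fderiv_form_apply hζ hX hY]
  simp only [lieBracket, form_sub_left]
  rw [form_swap (ζ y) (Y y) (fderiv 𝕜 Z y (X y)), form_swap (ζ y) (X y) (fderiv 𝕜 Z y (Y y)),
    form_swap (ζ y) (X y) (fderiv 𝕜 Y y (Z y))]
  abel

theorem fderiv_fderiv_apply_of_hamiltonian {f g : E → F}
    (hζ : DifferentiableAt 𝕜 ζ y) (hdζ : extDeriv ζ y = 0)
    (hX : DifferentiableAt 𝕜 X y) (hY : DifferentiableAt 𝕜 Y y)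
    (hf : ContDiffAt 𝕜 (minSmoothness 𝕜 2) f y) (hg : ContDiffAt 𝕜 (minSmoothness 𝕜 2) g y)
    (hfX : ∀ᶠ z in 𝓝 y, ∀ w, fderiv 𝕜 f z w = -ζ z ![X z, w])
    (hgY : ∀ᶠ z in 𝓝 y, ∀ w, fderiv 𝕜 g z w = -ζ z ![Y z, w]) (w : E) :
    fderiv 𝕜 (fun z => fderiv 𝕜 g z (X z)) y w = -ζ y ![lieBracket 𝕜 X Y y, w] := by
  have hform {h : E → F} {Z : E → E} (hhZ : ∀ᶠ z in 𝓝 y, ∀ w, fderiv 𝕜 h z w = -ζ z ![Z z, w])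
      (W : E → E) (u : E) :
      fderiv 𝕜 (fun z => ζ z ![Z z, W z]) y u = -fderiv 𝕜 (fun z => fderiv 𝕜 h z (W z)) y u := by
    have heq : (fun z => ζ z ![Z z, W z]) =ᶠ[𝓝 y] fun z => -fderiv 𝕜 h z (W z) :=
      hhZ.mono fun z hz => by simp only [hz, neg_neg]
    rw [heq.fderiv_eq, fderiv_fun_neg, neg_apply]
  have hw : DifferentiableAt 𝕜 (fun _ : E => w) y := differentiableAt_const w
  have hXw := fderiv_apply_lieBracket hg le_rfl hw hX
  have hYw := fderiv_apply_lieBracket hf le_rfl hw hY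
  -- `0 = dζ(X, Y, w)` with `w` extended to a constant vector field.
  have hcartan := extDeriv_apply_three_vectorFields hζ hX hY hw
  rw [hdζ, ContinuousAlternatingMap.coe_zero, Pi.zero_apply, hform hgY, hform hfX, hform hfX,
    form_swap _ (lieBracket 𝕜 X _ y) (Y y), form_swap _ (lieBracket 𝕜 Y _ y) (X y),
    ← hgY.self_of_nhds, ← hfX.self_of_nhds, hXw, hYw] at hcartan
  linear_combination (norm := module) hcartan

end VectorSpace

section Chart

open VectorField Filter Topology Set

variable {E H M : Type*} [NormedAddCommGroup E] [NormedSpace ℝ E] [TopologicalSpace H]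
  {I : ModelWithCorners ℝ E H} [TopologicalSpace M] [ChartedSpace H M]

variable (I) in
/-- The representation of a vector field on `M` in the chart at `x₀`, that is, its pullback along
the inverse of the chart. It is meaningful on the target of the chart. -/
def fieldInChart (X : (x : M) → TangentSpace I x) (x₀ : M) : E → E :=
  mpullback 𝓘(ℝ, E) I (extChartAt I x₀).symm X

variable (I) in
theorem exists_extChartAt_symm_eq (x : M) :
    ∃ x₀ : M, ∃ y ∈ (extChartAt I x₀).target, (extChartAt I x₀).symm y = x :=
  ⟨x, extChartAt I x x, mem_extChartAt_target x, extChartAt_to_inv x⟩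

theorem minSmoothness_two_le_infty : minSmoothness ℝ 2 ≤ ∞ := by
  simpa using by norm_cast

variable [I.Boundaryless] [IsManifold I ∞ M] {x₀ : M} {y : E}

theorem contMDiffAt_extChartAt_symm (hy : y ∈ (extChartAt I x₀).target) :
    ContMDiffAt 𝓘(ℝ, E) I ∞ (extChartAt I x₀).symm y :=
  (contMDiffOn_extChartAt_symm x₀).contMDiffAt ((isOpen_extChartAt_target x₀).mem_nhds hy)

theorem isInvertible_mfderiv_extChartAt_symm (hy : y ∈ (extChartAt I x₀).target) :
    (mfderiv 𝓘(ℝ, E) I (extChartAt I x₀).symm y).IsInvertible := by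
  have : IsManifold I 1 M := IsManifold.of_le (n := ∞) (by simp)
  have hinv := isInvertible_mfderivWithin_extChartAt_symm hy
  rwa [I.range_eq_univ, mfderivWithin_univ] at hinv

theorem mfderiv_extChartAt_symm_fieldInChart (X : (x : M) → TangentSpace I x)
    (hy : y ∈ (extChartAt I x₀).target) :
    mfderiv 𝓘(ℝ, E) I (extChartAt I x₀).symm y (fieldInChart I X x₀ y : E) =
      X ((extChartAt I x₀).symm y) := by
  rw [fieldInChart, mpullback_apply,
    (isInvertible_mfderiv_extChartAt_symm hy).self_apply_inverse]

theorem exists_mfderiv_extChartAt_symm_eq (hy : y ∈ (extChartAt I x₀).target)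
    (w : TangentSpace I ((extChartAt I x₀).symm y)) :
    ∃ u : E, mfderiv 𝓘(ℝ, E) I (extChartAt I x₀).symm y u = w :=
  (isInvertible_mfderiv_extChartAt_symm hy).surjective w

theorem fderiv_comp_extChartAt_symm {f : M → ℝ} (hf : ContMDiff I 𝓘(ℝ, ℝ) ∞ f)
    (hy : y ∈ (extChartAt I x₀).target) (u : E) :
    fderiv ℝ (f ∘ (extChartAt I x₀).symm) y u =
      mvfderiv I f ((extChartAt I x₀).symm y)
        (mfderiv 𝓘(ℝ, E) I (extChartAt I x₀).symm y u) := by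
  have hcomp := mvfderiv_comp_apply y (hf.mdifferentiableAt (by simp))
    ((contMDiffAt_extChartAt_symm hy).mdifferentiableAt (by simp)) u
  rwa [mvfderiv, mfderiv_eq_fderiv] at hcomp

theorem contDiffAt_comp_extChartAt_symm {f : M → ℝ} (hf : ContMDiff I 𝓘(ℝ, ℝ) ∞ f)
    (hy : y ∈ (extChartAt I x₀).target) : ContDiffAt ℝ ∞ (f ∘ (extChartAt I x₀).symm) y :=
  ((hf _).comp y (contMDiffAt_extChartAt_symm hy)).contDiffAt

variable [CompleteSpace E] {X Y : (x : M) → TangentSpace I x}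

theorem differentiableAt_fieldInChart
    (hX : ContMDiff I I.tangent ∞ fun x => (⟨x, X x⟩ : TangentBundle I M))
    (hy : y ∈ (extChartAt I x₀).target) : DifferentiableAt ℝ (fieldInChart I X x₀) y := by
  have : IsManifold I (1 + 1) M := IsManifold.of_le (n := ∞) (by norm_cast)
  have hpullback : ContMDiffAt 𝓘(ℝ, E) 𝓘(ℝ, E).tangent 1
      (fun z => (⟨z, (fieldInChart I X x₀ z : E)⟩ : TangentBundle 𝓘(ℝ, E) E)) y :=
    ContMDiffAt.mpullback_vectorField_preimage (n := ∞) ((hX _).of_le (by norm_cast))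
      (contMDiffAt_extChartAt_symm hy) (isInvertible_mfderiv_extChartAt_symm hy) (by norm_cast)
  exact (contMDiffAt_vectorSpace_iff_contDiffAt.1 hpullback).differentiableAt one_ne_zero

theorem fieldInChart_mlieBracket
    (hX : ContMDiff I I.tangent ∞ fun x => (⟨x, X x⟩ : TangentBundle I M))
    (hY : ContMDiff I I.tangent ∞ fun x => (⟨x, Y x⟩ : TangentBundle I M))
    (hy : y ∈ (extChartAt I x₀).target) :
    fieldInChart I (mlieBracket I X Y) x₀ y =
      lieBracket ℝ (fieldInChart I X x₀) (fieldInChart I Y x₀) y := by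
  have : IsManifold I (minSmoothness ℝ 2) M :=
    IsManifold.of_le (n := ∞) minSmoothness_two_le_infty
  rw [fieldInChart, mpullback_mlieBracket (n := ∞) (hX.mdifferentiableAt (by simp))
    (hY.mdifferentiableAt (by simp)) (contMDiffAt_extChartAt_symm hy)
    minSmoothness_two_le_infty, ← mlieBracketWithin_univ,
    mlieBracketWithin_eq_lieBracketWithin, ← lieBracketWithin_univ]
  rfl

end Chart

section Fields

open VectorField Filter Topology

variable {E H : Type*} [NormedAddCommGroup E] [NormedSpace ℝ E] [TopologicalSpace H]
  (I : ModelWithCorners ℝ E H) (M : Type*) [TopologicalSpace M] [ChartedSpace H M]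

/-- Smooth real functions on `M`. -/
abbrev SmoothFunction : Type _ := C^∞⟮I, M; ℝ⟯

/-- Smooth vector fields on `M`. -/
abbrev SmoothField [IsManifold I ∞ M] : Type _ :=
  Cₛ^∞⟮I; E, (TangentSpace I : M → Type _)⟯

variable {I M}

theorem mvfderiv_smoothFunction_mul (f g : SmoothFunction I M) (x : M) (v : TangentSpace I x) :
    mvfderiv I (⇑(f * g)) x v = f x * mvfderiv I g x v + g x * mvfderiv I f x v := by
  rw [ContMDiffMap.coe_mul, mvfderiv_mul f.mdifferentiableAt g.mdifferentiableAt, add_apply]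
  rfl

/-- The derivative of smooth functions at a point, in the direction of a tangent vector. -/
def dirDeriv (x : M) (v : TangentSpace I x) : SmoothFunction I M →ₗ[ℝ] ℝ where
  toFun f := mvfderiv I f x v
  map_add' f g := by
    rw [ContMDiffMap.coe_add, mvfderiv_add f.mdifferentiableAt g.mdifferentiableAt, add_apply]
  map_smul' c f :=
    congrArg (fun L => L v) (const_smul_mfderiv (I := I) (f.mdifferentiableAt (x := x)) c)

variable [IsManifold I ∞ M]

theorem contMDiff_mvfderiv_apply (X : SmoothField I M) (g : SmoothFunction I M) :
    ContMDiff I 𝓘(ℝ, ℝ) ∞ fun x => mvfderiv I g x (X x) :=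
  ((contMDiff_snd_tangentBundle_modelSpace ℝ 𝓘(ℝ, ℝ)).comp
    (g.contMDiff.contMDiff_tangentMap (by simp))).comp X.contMDiff

/-- The derivative `X(g)` of a smooth function along a smooth vector field. -/
def lieDeriv : SmoothField I M →ₗ[ℝ] SmoothFunction I M →ₗ[ℝ] SmoothFunction I M :=
  LinearMap.mk₂ ℝ (fun X g => ⟨fun x => mvfderiv I g x (X x), contMDiff_mvfderiv_apply X g⟩)
    (fun X Y g => by ext x; exact map_add (mvfderiv I g x) (X x) (Y x))
    (fun c X g => by ext x; exact map_smul (mvfderiv I g x) c (X x))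
    (fun X f g => by ext x; exact map_add (dirDeriv x (X x)) f g)
    (fun c X g => by ext x; exact map_smul (dirDeriv x (X x)) c g)

theorem lieDeriv_apply (X : SmoothField I M) (g : SmoothFunction I M) (x : M) :
    lieDeriv X g x = mvfderiv I g x (X x) :=
  rfl

theorem lieDeriv_mul (X : SmoothField I M) (f g : SmoothFunction I M) :
    lieDeriv X (f * g) = lieDeriv X f * g + f * lieDeriv X g := by
  ext x
  simp only [lieDeriv_apply, ContMDiffMap.coe_add, ContMDiffMap.coe_mul, Pi.add_apply,
    Pi.mul_apply]
  rw [← ContMDiffMap.coe_mul, mvfderiv_smoothFunction_mul]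
  ring

/-- The product of a smooth function and a smooth vector field. -/
def fieldSMul : SmoothFunction I M →ₗ[ℝ] SmoothField I M →ₗ[ℝ] SmoothField I M :=
  LinearMap.mk₂ ℝ (fun f X => ⟨fun x => f x • X x, f.contMDiff.smul_section X.contMDiff⟩)
    (fun f g X => by ext1 x; exact add_smul (f x) (g x) (X x))
    (fun c f X => by ext1 x; exact mul_smul c (f x) (X x))
    (fun f X Y => by ext1 x; exact smul_add (f x) (X x) (Y x))
    (fun c f X => by ext1 x; exact smul_comm (f x) c (X x))

/-- The Lie bracket of smooth vector fields. -/
def fieldBracket [CompleteSpace E] :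
    SmoothField I M →ₗ[ℝ] SmoothField I M →ₗ[ℝ] SmoothField I M :=
  haveI : IsManifold I (minSmoothness ℝ 2) M :=
    IsManifold.of_le (n := ∞) minSmoothness_two_le_infty
  LinearMap.mk₂ ℝ (fun X Y => ⟨mlieBracket I X Y,
      haveI : IsManifold I ((⊤ : ℕ∞) + 1) M := by simpa
      ContDiff.mlieBracket_vectorField (m := ⊤) (n := ⊤) X.contMDiff Y.contMDiff (by simp)⟩)
    (fun X Y Z => by
      ext1 x; exact mlieBracket_add_left X.mdifferentiableAt Y.mdifferentiableAt)
    (fun c X Y => by ext1 x; exact mlieBracket_const_smul_left X.mdifferentiableAt)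
    (fun X Y Z => by
      ext1 x; exact mlieBracket_add_right Y.mdifferentiableAt Z.mdifferentiableAt)
    (fun c X Y => by ext1 x; exact mlieBracket_const_smul_right Y.mdifferentiableAt)

theorem coe_fieldBracket [CompleteSpace E] (X Y : SmoothField I M) :
    ⇑(fieldBracket X Y) = mlieBracket I X Y :=
  rfl

variable [I.Boundaryless]

theorem lieDeriv_extChartAt_symm (X : SmoothField I M) (g : SmoothFunction I M) {x₀ : M} {y : E}
    (hy : y ∈ (extChartAt I x₀).target) :
    lieDeriv X g ((extChartAt I x₀).symm y) =
      fderiv ℝ (g ∘ (extChartAt I x₀).symm) y (fieldInChart I X x₀ y) := by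
  rw [fderiv_comp_extChartAt_symm g.contMDiff hy, mfderiv_extChartAt_symm_fieldInChart _ hy,
    lieDeriv_apply]

theorem lieDeriv_comp_extChartAt_symm_eventuallyEq (X : SmoothField I M)
    (g : SmoothFunction I M) {x₀ : M} {y : E} (hy : y ∈ (extChartAt I x₀).target) :
    lieDeriv X g ∘ (extChartAt I x₀).symm =ᶠ[𝓝 y]
      fun z => fderiv ℝ (g ∘ (extChartAt I x₀).symm) z (fieldInChart I X x₀ z) := by
  filter_upwards [(isOpen_extChartAt_target x₀).mem_nhds hy] with z hz
  exact lieDeriv_extChartAt_symm X g hz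

theorem lieDeriv_fieldBracket [CompleteSpace E] (X Y : SmoothField I M)
    (f : SmoothFunction I M) :
    lieDeriv (fieldBracket X Y) f = lieDeriv X (lieDeriv Y f) - lieDeriv Y (lieDeriv X f) := by
  ext x
  obtain ⟨x₀, y, hy, rfl⟩ := exists_extChartAt_symm_eq I x
  have hf : ContDiffAt ℝ (minSmoothness ℝ 2) (f ∘ (extChartAt I x₀).symm) y :=
    (contDiffAt_comp_extChartAt_symm f.contMDiff hy).of_le minSmoothness_two_le_infty
  rw [ContMDiffMap.coe_sub, Pi.sub_apply, lieDeriv_extChartAt_symm _ _ hy,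
    lieDeriv_extChartAt_symm _ _ hy, lieDeriv_extChartAt_symm _ _ hy,
    (lieDeriv_comp_extChartAt_symm_eventuallyEq X f hy).fderiv_eq,
    (lieDeriv_comp_extChartAt_symm_eventuallyEq Y f hy).fderiv_eq,
    ← fderiv_apply_lieBracket hf le_rfl (differentiableAt_fieldInChart Y.contMDiff hy)
      (differentiableAt_fieldInChart X.contMDiff hy),
    ← fieldInChart_mlieBracket X.contMDiff Y.contMDiff hy, coe_fieldBracket]

end Fields

section HamiltonianField

open VectorField Filter Topology

section Algebra

variable {E H M : Type*} [NormedAddCommGroup E] [NormedSpace ℝ E] [TopologicalSpace H]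
  {I : ModelWithCorners ℝ E H} [TopologicalSpace M] [ChartedSpace H M] [IsManifold I ∞ M]

/-- `X` is a Hamiltonian vector field of `f` for the 2-form `η`: `df = -X ⌟ η`. The form need not
be non-degenerate, so `X` need not be unique. -/
def IsHamiltonianField (η : (x : M) → (TangentSpace I x) [⋀^Fin 2]→L[ℝ] ℝ)
    (X : SmoothField I M) (f : SmoothFunction I M) : Prop :=
  ∀ (x : M) (w : TangentSpace I x), mvfderiv I f x w = -η x ![X x, w]

namespace IsHamiltonianField

variable {η : (x : M) → (TangentSpace I x) [⋀^Fin 2]→L[ℝ] ℝ} {X Y : SmoothField I M}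
  {f g : SmoothFunction I M}

theorem zero : IsHamiltonianField η 0 0 := fun x w =>
  (map_zero (dirDeriv x w)).trans (neg_eq_zero.2 (form_zero_left (η x) w)).symm

theorem add (hX : IsHamiltonianField η X f) (hY : IsHamiltonianField η Y g) :
    IsHamiltonianField η (X + Y) (f + g) := fun x w =>
  calc mvfderiv I (⇑(f + g)) x w
      = mvfderiv I f x w + mvfderiv I g x w := map_add (dirDeriv x w) f g
    _ = -(η x ![X x, w] + η x ![Y x, w]) := by rw [hX, hY, neg_add]
    _ = -η x ![(X + Y) x, w] := congrArg Neg.neg (form_add_left (η x) (X x) (Y x) w).symm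

theorem lieDeriv_eq (hX : IsHamiltonianField η X f) (hY : IsHamiltonianField η Y g) :
    lieDeriv X g = -lieDeriv Y f := by
  ext x
  rw [ContMDiffMap.coe_neg, Pi.neg_apply, lieDeriv_apply, lieDeriv_apply, hX, hY, form_swap]

theorem lieDeriv_self (hX : IsHamiltonianField η X f) : lieDeriv X f = 0 := by
  ext x
  rw [lieDeriv_apply, hX, (η x).map_eq_zero_of_eq ![X x, X x] (i := 0) (j := 1) rfl (by simp)]
  exact neg_zero

theorem mul (hX : IsHamiltonianField η X f) (hY : IsHamiltonianField η Y g) :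
    IsHamiltonianField η (fieldSMul g X + fieldSMul f Y) (f * g) := fun x w => by
  have hform : η x ![(fieldSMul g X + fieldSMul f Y) x, w] =
      g x * η x ![X x, w] + f x * η x ![Y x, w] := by
    rw [← form_smul_left, ← form_smul_left]
    exact form_add_left (η x) (g x • X x) (f x • Y x) w
  rw [mvfderiv_smoothFunction_mul, hform, hX, hY]
  ring

end IsHamiltonianField

end Algebra

variable {N : ℕ} {P : Type*} [TopologicalSpace P] [ChartedSpace (EuclideanSpace ℝ (Fin N)) P]

theorem IsSmoothForm.differentiableAt_formInChart {k : ℕ}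
    {η : (x : P) → (TangentSpace (𝓡 N) x) [⋀^Fin k]→L[ℝ] ℝ} (hη : IsSmoothForm η) {x₀ : P}
    {y : EuclideanSpace ℝ (Fin N)} (hy : y ∈ (extChartAt (𝓡 N) x₀).target) :
    DifferentiableAt ℝ (formInChart η x₀) y :=
  ((hη x₀).contDiffAt ((isOpen_extChartAt_target x₀).mem_nhds hy)).differentiableAt (by simp)

variable (N P) in
/-- The space of smooth closed `k`-forms on `P`. -/
def closedForms (k : ℕ) :
    Submodule ℝ ((x : P) → (TangentSpace (𝓡 N) x) [⋀^Fin k]→L[ℝ] ℝ) where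
  carrier := {η | IsSmoothForm η ∧ IsClosedForm η}
  add_mem' {η θ} hη hθ := ⟨fun x₀ => (hη.1 x₀).add (hθ.1 x₀), fun x₀ y hy => by
    have hadd := extDeriv_add (hη.1.differentiableAt_formInChart hy)
      (hθ.1.differentiableAt_formInChart hy)
    rwa [hη.2 x₀ y hy, hθ.2 x₀ y hy, add_zero] at hadd⟩
  zero_mem' := ⟨fun _ => contDiffOn_const (c := 0), fun x₀ y _ => by
    have hsmul := extDeriv_smul (0 : ℝ) (formInChart (k := k) 0 x₀) (x := y)
    rwa [zero_smul, zero_smul] at hsmul⟩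
  smul_mem' c η hη := ⟨fun x₀ => (hη.1 x₀).const_smul c, fun x₀ y hy => by
    have hsmul := extDeriv_smul c (formInChart η x₀) (x := y)
    rwa [hη.2 x₀ y hy, smul_zero] at hsmul⟩

theorem formInChart_apply_two (η : (x : P) → (TangentSpace (𝓡 N) x) [⋀^Fin 2]→L[ℝ] ℝ) (x₀ : P)
    (y u w : EuclideanSpace ℝ (Fin N)) :
    formInChart η x₀ y ![u, w] = η ((extChartAt (𝓡 N) x₀).symm y)
      ![mfderiv 𝓘(ℝ, EuclideanSpace ℝ (Fin N)) (𝓡 N) (extChartAt (𝓡 N) x₀).symm y u,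
        mfderiv 𝓘(ℝ, EuclideanSpace ℝ (Fin N)) (𝓡 N) (extChartAt (𝓡 N) x₀).symm y w] := by
  refine congrArg (η ((extChartAt (𝓡 N) x₀).symm y)) ?_
  ext1 i
  fin_cases i <;> rfl

namespace IsHamiltonianField

variable [IsManifold (𝓡 N) ∞ P] {η : (x : P) → (TangentSpace (𝓡 N) x) [⋀^Fin 2]→L[ℝ] ℝ}
  {X Y Z : SmoothField (𝓡 N) P} {f g h : SmoothFunction (𝓡 N) P}

theorem fderiv_comp_extChartAt_symm (hX : IsHamiltonianField η X f) {x₀ : P}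
    {y : EuclideanSpace ℝ (Fin N)} (hy : y ∈ (extChartAt (𝓡 N) x₀).target)
    (w : EuclideanSpace ℝ (Fin N)) :
    fderiv ℝ (f ∘ (extChartAt (𝓡 N) x₀).symm) y w =
      -formInChart η x₀ y ![fieldInChart (𝓡 N) X x₀ y, w] := by
  rw [NSymplectic.fderiv_comp_extChartAt_symm f.contMDiff hy, hX, formInChart_apply_two,
    mfderiv_extChartAt_symm_fieldInChart X hy]

theorem bracket (hη : η ∈ closedForms N P 2) (hX : IsHamiltonianField η X f)
    (hY : IsHamiltonianField η Y g) :
    IsHamiltonianField η (fieldBracket X Y) (lieDeriv X g) := fun x w => by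
  obtain ⟨x₀, y, hy, rfl⟩ := exists_extChartAt_symm_eq (𝓡 N) x
  obtain ⟨u, rfl⟩ := exists_mfderiv_extChartAt_symm_eq hy w
  have htarget := (isOpen_extChartAt_target x₀).mem_nhds hy
  have hC2 (φ : SmoothFunction (𝓡 N) P) :
      ContDiffAt ℝ (minSmoothness ℝ 2) (φ ∘ (extChartAt (𝓡 N) x₀).symm) y :=
    (contDiffAt_comp_extChartAt_symm φ.contMDiff hy).of_le minSmoothness_two_le_infty
  rw [← NSymplectic.fderiv_comp_extChartAt_symm (lieDeriv X g).contMDiff hy,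
    (lieDeriv_comp_extChartAt_symm_eventuallyEq X g hy).fderiv_eq,
    fderiv_fderiv_apply_of_hamiltonian (hη.1.differentiableAt_formInChart hy) (hη.2 x₀ y hy)
      (differentiableAt_fieldInChart X.contMDiff hy) (differentiableAt_fieldInChart Y.contMDiff hy)
      (hC2 f) (hC2 g) (Filter.eventually_of_mem htarget fun z => hX.fderiv_comp_extChartAt_symm)
      (Filter.eventually_of_mem htarget fun z => hY.fderiv_comp_extChartAt_symm),
    ← fieldInChart_mlieBracket X.contMDiff Y.contMDiff hy, formInChart_apply_two,
    mfderiv_extChartAt_symm_fieldInChart _ hy, coe_fieldBracket]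

theorem jacobi (hη : η ∈ closedForms N P 2) (hX : IsHamiltonianField η X f)
    (hY : IsHamiltonianField η Y g) (hZ : IsHamiltonianField η Z h) :
    lieDeriv X (lieDeriv Y h) + lieDeriv Y (lieDeriv Z f) + lieDeriv Z (lieDeriv X g) = 0 := by
  rw [hZ.lieDeriv_eq (bracket hη hX hY), lieDeriv_fieldBracket, hZ.lieDeriv_eq hX, map_neg]
  abel

end IsHamiltonianField

end HamiltonianField

section Contraction

variable {n : ℕ} {V W U : Type*} [AddCommGroup V] [Module ℝ V] [AddCommGroup W] [Module ℝ W]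
  [AddCommGroup U] [Module ℝ U]

/-- The complete contraction of a family `T^{α₁ … α_m}` with the covector `ξ`, that is, the value
at `ξ` of the homogeneous polynomial `∑ T^{α₁ … α_m} ξ_{α₁} … ξ_{α_m}`. -/
def contract (ξ : Fin n → ℝ) (m : ℕ) : (MultiIndex n m → V) →ₗ[ℝ] V :=
  ∑ α, (∏ i, ξ (α i)) • LinearMap.proj α

theorem contract_apply (ξ : Fin n → ℝ) {m : ℕ} (T : MultiIndex n m → V) :
    contract ξ m T = ∑ α, (∏ i, ξ (α i)) • T α := by
  simp [contract]

theorem contract_map (ξ : Fin n → ℝ) {m : ℕ} (L : V →ₗ[ℝ] W) (T : MultiIndex n m → V) :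
    contract ξ m (fun α => L (T α)) = L (contract ξ m T) := by
  simp [contract_apply]

theorem symmetrize_map {m : ℕ} (L : V →ₗ[ℝ] W) (T : MultiIndex n m → V) (α : MultiIndex n m) :
    symmetrize (fun β => L (T β)) α = L (symmetrize T α) := by
  simp [symmetrize]

theorem isSymm_symmetrize {m : ℕ} (T : MultiIndex n m → V) :
    IsSymm (symmetrize T : MultiIndex n m → V) := fun σ _ =>
  congrArg ((m.factorial : ℝ)⁻¹ • ·) (Fintype.sum_equiv (Equiv.mulLeft σ) _ _ fun _ => rfl)

theorem contract_smul_covector (t : ℝ) (ξ : Fin n → ℝ) {m : ℕ} (T : MultiIndex n m → V) :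
    contract (t • ξ) m T = t ^ m • contract ξ m T := by
  simp [contract_apply, Finset.prod_mul_distrib, Finset.smul_sum, mul_smul]

theorem contract_comp_perm (ξ : Fin n → ℝ) {m : ℕ} (T : MultiIndex n m → V)
    (σ : Equiv.Perm (Fin m)) : contract ξ m (fun α => T (α ∘ σ)) = contract ξ m T := by
  rw [contract_apply, contract_apply]
  refine Fintype.sum_equiv (Equiv.arrowCongr σ.symm (Equiv.refl _)) _ _ fun α => ?_
  have hcomp : (Equiv.arrowCongr σ.symm (Equiv.refl (Fin n))) α = α ∘ σ := by
    ext i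
    simp
  rw [hcomp, ← Equiv.prod_comp σ]
  rfl

theorem contract_symmetrize (ξ : Fin n → ℝ) {m : ℕ} (T : MultiIndex n m → V) :
    contract ξ m (symmetrize T) = contract ξ m T := by
  have hsymmetrize : (symmetrize T : MultiIndex n m → V) =
      ((m.factorial : ℝ)⁻¹) • ∑ σ : Equiv.Perm (Fin m), fun α => T (α ∘ σ) := by
    ext α
    simp [symmetrize]
  rw [hsymmetrize, map_smul, map_sum]
  simp only [contract_comp_perm]
  rw [Finset.sum_const, Finset.card_univ, Fintype.card_perm, Fintype.card_fin,
    ← Nat.cast_smul_eq_nsmul ℝ, smul_smul, inv_mul_cancel₀ (by positivity), one_smul]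

theorem contract_append (ξ : Fin n → ℝ) {p q : ℕ} (B : V →ₗ[ℝ] W →ₗ[ℝ] U)
    (S : MultiIndex n p → V) (T : MultiIndex n q → W) :
    contract ξ (p + q) (fun β : MultiIndex n (p + q) =>
      B (S fun i => β (Fin.castAdd q i)) (T fun j => β (Fin.natAdd p j))) =
      B (contract ξ p S) (contract ξ q T) := by
  simp only [contract_apply]
  rw [← (Fin.appendEquiv p q).sum_comp, Fintype.sum_prod_type]
  simp only [map_sum, map_smul, LinearMap.sum_apply, LinearMap.smul_apply, Finset.smul_sum,
    smul_smul]
  rw [Finset.sum_comm]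
  refine Finset.sum_congr rfl fun β _ => Finset.sum_congr rfl fun α _ => ?_
  rw [mul_comm]
  simp [Fin.appendEquiv, Fin.prod_univ_add]

theorem contract_last (ξ : Fin n → ℝ) {k : ℕ} (B : V →ₗ[ℝ] W →ₗ[ℝ] U)
    (S : MultiIndex n k → V) (T : Fin n → W) :
    contract ξ (k + 1)
      (fun β : MultiIndex n (k + 1) => B (S fun i => β i.castSucc) (T (β (Fin.last k)))) =
      B (contract ξ k S) (∑ γ, ξ γ • T γ) := by
  have hone : contract ξ 1 (fun β : MultiIndex n 1 => T (β 0)) = ∑ γ, ξ γ • T γ := by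
    rw [contract_apply]
    refine Fintype.sum_equiv (Equiv.funUnique (Fin 1) (Fin n)) _ _ fun α => ?_
    simp
  rw [← hone, ← contract_append ξ B S]
  rfl

theorem contract_cast (ξ : Fin n → ℝ) {m m' : ℕ} (h : m = m') (T : MultiIndex n m → V) :
    contract ξ m' (fun β => T fun i => β (Fin.cast h i)) = contract ξ m T := by
  subst h
  rfl

/-- The exponent `c ↦ #{i | αᵢ = c}` of the monomial `ξ_{α₁} … ξ_{α_m}`. -/
def monomialExponent {m : ℕ} (α : MultiIndex n m) : Fin n →₀ ℕ :=
  ∑ i, Finsupp.single (α i) 1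

theorem exists_eq_comp_perm_of_monomialExponent_eq {m : ℕ} {α β : MultiIndex n m}
    (h : monomialExponent α = monomialExponent β) : ∃ σ : Equiv.Perm (Fin m), α = β ∘ σ := by
  have hcard : ∀ c, Fintype.card {i // α i = c} = Fintype.card {i // β i = c} := fun c => by
    simpa [monomialExponent, Finsupp.finsetSum_apply, Finsupp.single_apply,
      Fintype.card_subtype] using DFunLike.congr_fun h c
  let fiberEquiv c := Fintype.equivOfCardEq (hcard c)
  refine ⟨(Equiv.sigmaFiberEquiv α).symm.trans
    ((Equiv.sigmaCongrRight fiberEquiv).trans (Equiv.sigmaFiberEquiv β)), ?_⟩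
  funext i
  exact (fiberEquiv (α i) ⟨i, rfl⟩).2.symm

/-- The polynomial `∑ T^{α₁ … α_m} ξ_{α₁} … ξ_{α_m}` in `ξ`. -/
def contractPolynomial {m : ℕ} (T : MultiIndex n m → ℝ) : MvPolynomial (Fin n) ℝ :=
  ∑ α, MvPolynomial.monomial (monomialExponent α) (T α)

theorem eval_contractPolynomial {m : ℕ} (T : MultiIndex n m → ℝ) (ξ : Fin n → ℝ) :
    MvPolynomial.eval ξ (contractPolynomial T) = contract ξ m T := by
  simp only [contractPolynomial, contract_apply, map_sum, MvPolynomial.eval_monomial,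
    monomialExponent, smul_eq_mul]
  refine Finset.sum_congr rfl fun α _ => ?_
  rw [← Finsupp.prod_finsetSum_index (by simp) (by simp [pow_add]), mul_comm]
  simp

open Classical in
theorem IsSymm.coeff_contractPolynomial {m : ℕ} {T : MultiIndex n m → ℝ} (hT : IsSymm T)
    (α : MultiIndex n m) :
    (contractPolynomial T).coeff (monomialExponent α) =
      Finset.card {β : MultiIndex n m | monomialExponent β = monomialExponent α} * T α := by
  rw [contractPolynomial, MvPolynomial.coeff_sum, ← nsmul_eq_mul, ← Finset.sum_const,
    Finset.sum_filter]
  refine Finset.sum_congr rfl fun β _ => ?_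
  rw [MvPolynomial.coeff_monomial]
  refine ite_congr rfl (fun hβ => ?_) fun _ => rfl
  obtain ⟨σ, rfl⟩ := exists_eq_comp_perm_of_monomialExponent_eq hβ
  exact hT σ α

theorem IsSymm.eq_zero_of_contract_eq_zero {m : ℕ} {T : MultiIndex n m → ℝ} (hT : IsSymm T)
    (h : ∀ ξ, contract ξ m T = 0) : T = 0 := by
  classical
  have hpolynomial : contractPolynomial T = 0 := MvPolynomial.funext fun ξ => by
    rw [eval_contractPolynomial, h, map_zero]
  ext α
  have hcoeff := hT.coeff_contractPolynomial α
  rw [hpolynomial, MvPolynomial.coeff_zero, eq_comm, mul_eq_zero, Nat.cast_eq_zero] at hcoeff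
  exact hcoeff.resolve_left (Finset.card_ne_zero.2 ⟨α, by simp⟩)

theorem IsSymm.ext_contract {m : ℕ} {S T : MultiIndex n m → V} (hS : IsSymm S) (hT : IsSymm T)
    (h : ∀ ξ, contract ξ m S = contract ξ m T) : S = T := by
  ext α
  refine sub_eq_zero.1 ((Module.forall_dual_apply_eq_zero_iff ℝ _).1 fun L => ?_)
  have hzero : (fun β => L (S β - T β)) = 0 :=
    IsSymm.eq_zero_of_contract_eq_zero (fun σ β => by simp only [hS σ β, hT σ β]) fun ξ => by
      rw [contract_map ξ L fun β => S β - T β]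
      exact (congrArg L ((map_sub (contract ξ m) S T).trans (sub_eq_zero.2 (h ξ)))).trans
        (map_zero L)
  exact congrFun hzero α

theorem eq_zero_of_forall_sum_pow_smul_eq_zero {ι : Type*} {d : ι → ℕ} (hd : d.Injective)
    {s : Finset ι} {v : ι → V} (h : ∀ t : ℝ, ∑ i ∈ s, t ^ d i • v i = 0) {i : ι} (hi : i ∈ s) :
    v i = 0 := by
  classical
  refine (Module.forall_dual_apply_eq_zero_iff ℝ _).1 fun L => ?_
  have hpolynomial : ∑ j ∈ s, Polynomial.monomial (d j) (L (v j)) = 0 :=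
    Polynomial.funext fun t => by
      simpa [Polynomial.eval_finsetSum, mul_comm] using congrArg L (h t)
  simpa [Polynomial.finsetSum_coeff, Polynomial.coeff_monomial, hd.eq_iff, hi] using
    congrArg (Polynomial.coeff · (d i)) hpolynomial

end Contraction

section SymmetricHamiltonianFunctions

variable {N n : ℕ} {P : Type*} [TopologicalSpace P] [ChartedSpace (EuclideanSpace ℝ (Fin N)) P]

/-- The scalar 2-form `ω_ξ = ∑ ξ_γ ω^γ`. -/
def GeneralNSymplecticStructure.contractedForm (Ω : GeneralNSymplecticStructure N n P)
    (ξ : Fin n → ℝ) : (x : P) → (TangentSpace (𝓡 N) x) [⋀^Fin 2]→L[ℝ] ℝ :=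
  ∑ γ, ξ γ • Ω.form γ

theorem GeneralNSymplecticStructure.contractedForm_mem_closedForms
    (Ω : GeneralNSymplecticStructure N n P) (ξ : Fin n → ℝ) :
    Ω.contractedForm ξ ∈ closedForms N P 2 :=
  Submodule.sum_mem _ fun γ _ => Submodule.smul_mem _ _ ⟨Ω.smooth γ, Ω.closed γ⟩

theorem isSymm_symProduct {p q : ℕ} (f : TensorFunction N n P p) (g : TensorFunction N n P q) :
    IsSymm (symProduct f g) :=
  isSymm_symmetrize _

theorem contract_symProduct (ξ : Fin n → ℝ) {p q : ℕ} (f : TensorFunction N n P p)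
    (g : TensorFunction N n P q) :
    contract ξ (p + q) (symProduct f g) = contract ξ p f * contract ξ q g :=
  (contract_symmetrize ξ _).trans
    (contract_append ξ (LinearMap.mul ℝ (SmoothFunction (𝓡 N) P)) f g)

variable [IsManifold (𝓡 N) ∞ P]

/-- The value `η(X(x), w)` as a bilinear function of the vector field `X` and the 2-covector `η`
at `x`. -/
def pairing (x : P) (w : TangentSpace (𝓡 N) x) :
    SmoothField (𝓡 N) P →ₗ[ℝ] ((TangentSpace (𝓡 N) x) [⋀^Fin 2]→L[ℝ] ℝ) →ₗ[ℝ] ℝ :=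
  LinearMap.mk₂ ℝ (fun X η => η ![X x, w])
    (fun X Y η => form_add_left η (X x) (Y x) w)
    (fun c X η => form_smul_left η c (X x) w)
    (fun _ _ _ => rfl)
    (fun _ _ _ => rfl)

/-- The components of the symmetrized interior product `X^{(α₁ … α_k} ⌟ ω^{α_{k+1})}`, evaluated
at the tangent vector `w`. -/
def symInteriorProduct (Ω : GeneralNSymplecticStructure N n P) {k : ℕ}
    (X : TensorVectorField N n P k) (x : P) (w : TangentSpace (𝓡 N) x) :
    MultiIndex n (k + 1) → ℝ :=
  symmetrize fun β => Ω.form (β (Fin.last k)) x ![X (fun i => β i.castSucc) x, w]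

theorem isSymm_symInteriorProduct (Ω : GeneralNSymplecticStructure N n P) {k : ℕ}
    (X : TensorVectorField N n P k) (x : P) (w : TangentSpace (𝓡 N) x) :
    IsSymm (symInteriorProduct Ω X x w) :=
  isSymm_symmetrize _

theorem contract_symInteriorProduct (Ω : GeneralNSymplecticStructure N n P) {k : ℕ}
    (X : TensorVectorField N n P k) (x : P) (w : TangentSpace (𝓡 N) x) (ξ : Fin n → ℝ) :
    contract ξ (k + 1) (symInteriorProduct Ω X x w) =
      Ω.contractedForm ξ x ![contract ξ k X x, w] := by
  have hform : Ω.contractedForm ξ x = ∑ γ, ξ γ • Ω.form γ x := by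
    simp [GeneralNSymplecticStructure.contractedForm]
  rw [hform]
  exact (contract_symmetrize ξ _).trans (contract_last ξ (pairing x w) X fun γ => Ω.form γ x)

/-- `X` is a family of Hamiltonian vector fields for `f` after contraction with every covector:
`d f_ξ = -X_ξ ⌟ ω_ξ`. The factor `(k + 1)!` of `IsHamiltonianFor` is absorbed in `X`. -/
def IsContractedHamiltonianFor (Ω : GeneralNSymplecticStructure N n P) {k : ℕ}
    (f : TensorFunction N n P (k + 1)) (X : TensorVectorField N n P k) : Prop :=
  ∀ ξ, IsHamiltonianField (Ω.contractedForm ξ) (contract ξ k X) (contract ξ (k + 1) f)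

theorem isHamiltonianFor_iff {Ω : GeneralNSymplecticStructure N n P} {k : ℕ}
    {f : TensorFunction N n P (k + 1)} (hf : IsSymm f) {X : TensorVectorField N n P k} :
    IsHamiltonianFor Ω f X ↔ IsContractedHamiltonianFor Ω f (((k + 1).factorial : ℝ) • X) := by
  let df x w : MultiIndex n (k + 1) → ℝ := fun α => dirDeriv x w (f α)
  let rhs x w : MultiIndex n (k + 1) → ℝ :=
    -((k + 1).factorial : ℝ) • symInteriorProduct Ω X x w
  have hdf ξ x w : contract ξ (k + 1) (df x w) =
      mvfderiv (𝓡 N) (contract ξ (k + 1) f : SmoothFunction (𝓡 N) P) x w :=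
    contract_map ξ (dirDeriv x w) f
  have hrhs ξ x w : contract ξ (k + 1) (rhs x w) =
      -Ω.contractedForm ξ x ![contract ξ k (((k + 1).factorial : ℝ) • X) x, w] := by
    rw [map_smul, map_smul, contract_symInteriorProduct, neg_smul]
    exact congrArg Neg.neg (form_smul_left _ _ _ _).symm
  have hsymm x w : IsSymm (df x w) ∧ IsSymm (rhs x w) :=
    ⟨fun σ α => congrArg (dirDeriv x w) (hf σ α), fun σ α =>
      congrArg (-((k + 1).factorial : ℝ) * ·) (isSymm_symInteriorProduct Ω X x w σ α)⟩
  constructor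
  · intro h ξ x w
    rw [← hdf, ← hrhs]
    exact congrArg (contract ξ (k + 1)) (funext fun α => h α x w)
  · intro h α x w
    refine congrFun (IsSymm.ext_contract (hsymm x w).1 (hsymm x w).2 fun ξ => ?_) α
    rw [hdf, hrhs]
    exact h ξ x w

theorem mem_SHF_iff {Ω : GeneralNSymplecticStructure N n P} {k : ℕ}
    {f : TensorFunction N n P (k + 1)} :
    f ∈ SHF Ω k ↔ IsSymm f ∧ ∃ X, IsContractedHamiltonianFor Ω f X := by
  refine and_congr_right fun hf => ⟨fun ⟨X, hX⟩ => ⟨_, (isHamiltonianFor_iff hf).1 hX⟩,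
    fun ⟨X, hX⟩ => ⟨((k + 1).factorial : ℝ)⁻¹ • X, (isHamiltonianFor_iff hf).2 ?_⟩⟩
  rwa [smul_inv_smul₀ (by positivity)]

/-- The symmetrized derivatives `X^{(α₁ … α_k}(g^{α_{k+1} … α_{k+m})})`. -/
def symLieDeriv {k m : ℕ} (X : TensorVectorField N n P k) (g : TensorFunction N n P m) :
    TensorFunction N n P (k + m) :=
  symmetrize fun β => lieDeriv (X fun i => β (Fin.castAdd m i)) (g fun j => β (Fin.natAdd k j))

theorem isSymm_symLieDeriv {k m : ℕ} (X : TensorVectorField N n P k)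
    (g : TensorFunction N n P m) : IsSymm (symLieDeriv X g) :=
  isSymm_symmetrize _

theorem contract_symLieDeriv (ξ : Fin n → ℝ) {k m : ℕ} (X : TensorVectorField N n P k)
    (g : TensorFunction N n P m) :
    contract ξ (k + m) (symLieDeriv X g) = lieDeriv (contract ξ k X) (contract ξ m g) :=
  (contract_symmetrize ξ _).trans (contract_append ξ lieDeriv X g)

theorem symLieDeriv_factorial_smul_apply {k l : ℕ} (X : TensorVectorField N n P k)
    (g : TensorFunction N n P (l + 1)) (α : MultiIndex n (k + l + 1)) (x : P) :
    symLieDeriv (((k + 1).factorial : ℝ) • X) g α x = bracketComponent X g α x := by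
  let evalAt : SmoothFunction (𝓡 N) P →ₗ[ℝ] ℝ :=
    LinearMap.proj x ∘ₗ ContMDiffMap.coeFnLinearMap
  let Xg (β : MultiIndex n (k + (l + 1))) : SmoothFunction (𝓡 N) P :=
    lieDeriv (X fun i => β (Fin.castAdd (l + 1) i)) (g fun j => β (Fin.natAdd k j))
  have hsmul : symLieDeriv (((k + 1).factorial : ℝ) • X) g α =
      ((k + 1).factorial : ℝ) • symmetrize Xg α :=
    (congrArg (symmetrize · α) (funext fun β => LinearMap.map_smul₂ lieDeriv _ _ _)).trans
      (symmetrize_map (LinearMap.lsmul ℝ _ _) Xg α)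
  rw [hsmul]
  exact congrArg (((k + 1).factorial : ℝ) * ·) (symmetrize_map evalAt Xg α).symm

namespace IsContractedHamiltonianFor

variable {Ω : GeneralNSymplecticStructure N n P} {k l : ℕ} {f : TensorFunction N n P (k + 1)}
  {g : TensorFunction N n P (l + 1)} {X X' : TensorVectorField N n P k}
  {Y : TensorVectorField N n P l}

theorem symLieDeriv_congr (hX : IsContractedHamiltonianFor Ω f X)
    (hX' : IsContractedHamiltonianFor Ω f X') (hY : IsContractedHamiltonianFor Ω g Y) :
    symLieDeriv X g = symLieDeriv X' g :=
  (isSymm_symLieDeriv X g).ext_contract (isSymm_symLieDeriv X' g) fun ξ => by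
    rw [contract_symLieDeriv, contract_symLieDeriv, (hX ξ).lieDeriv_eq (hY ξ),
      (hX' ξ).lieDeriv_eq (hY ξ)]

theorem symProduct_mem_SHF (hX : IsContractedHamiltonianFor Ω f X)
    (hY : IsContractedHamiltonianFor Ω g Y) : symProduct f g ∈ SHF Ω (k + 1 + l) := by
  let fY : TensorVectorField N n P (k + 1 + l) := fun β =>
    fieldSMul (f fun i => β (Fin.castAdd l i)) (Y fun j => β (Fin.natAdd (k + 1) j))
  let gX : TensorVectorField N n P (l + 1 + k) := fun β =>
    fieldSMul (g fun i => β (Fin.castAdd k i)) (X fun j => β (Fin.natAdd (l + 1) j))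
  have hrank : l + 1 + k = k + 1 + l := by omega
  refine mem_SHF_iff.2 ⟨isSymm_symProduct f g, (fun β => gX fun i => β (Fin.cast hrank i)) + fY,
    fun ξ => ?_⟩
  have hcontract := (hX ξ).mul (hY ξ)
  rw [← contract_append, ← contract_append, ← contract_symProduct, ← contract_cast ξ hrank,
    ← map_add] at hcontract
  exact hcontract

theorem symLieDeriv_mem_SHF (hX : IsContractedHamiltonianFor Ω f X)
    (hY : IsContractedHamiltonianFor Ω g Y) : symLieDeriv X g ∈ SHF Ω (k + l) := by
  refine mem_SHF_iff.2 ⟨isSymm_symLieDeriv X g, fun β =>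
    fieldBracket (X fun i => β (Fin.castAdd l i)) (Y fun j => β (Fin.natAdd k j)), fun ξ => ?_⟩
  have hbracket := (hX ξ).bracket (Ω.contractedForm_mem_closedForms ξ) (hY ξ)
  rw [← contract_append, ← contract_symLieDeriv] at hbracket
  exact hbracket

end IsContractedHamiltonianFor

end SymmetricHamiltonianFunctions

section TotalSpace

variable {N n : ℕ} {P : Type*} [TopologicalSpace P] [ChartedSpace (EuclideanSpace ℝ (Fin N)) P]
  [IsManifold (𝓡 N) ∞ P] {Ω : GeneralNSymplecticStructure N n P}

theorem SHF.ext_contract {k : ℕ} {f g : SHF Ω k}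
    (h : ∀ ξ, contract ξ (k + 1) f.1 = contract ξ (k + 1) g.1) : f = g :=
  Subtype.ext (f.2.1.ext_contract g.2.1 h)

/-- A choice of Hamiltonian vector fields for `f`, with the factor `(k + 1)!` absorbed. -/
def hamiltonianFields {k : ℕ} (f : SHF Ω k) : TensorVectorField N n P k :=
  (mem_SHF_iff.1 f.2).2.choose

theorem isContractedHamiltonianFor_hamiltonianFields {k : ℕ} (f : SHF Ω k) :
    IsContractedHamiltonianFor Ω f.1 (hamiltonianFields f) :=
  (mem_SHF_iff.1 f.2).2.choose_spec

/-- The symmetrized tensor product of two homogeneous elements of `SHF`. -/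
def SHF.mul {k l : ℕ} (f : SHF Ω k) (g : SHF Ω l) : SHF Ω (k + 1 + l) :=
  ⟨(symProduct f.1 g.1 : TensorFunction N n P (k + 1 + (l + 1))),
    (isContractedHamiltonianFor_hamiltonianFields f).symProduct_mem_SHF
      (isContractedHamiltonianFor_hamiltonianFields g)⟩

theorem SHF.contract_mul {k l : ℕ} (f : SHF Ω k) (g : SHF Ω l) (ξ : Fin n → ℝ) :
    contract ξ (k + 1 + l + 1) (SHF.mul f g).1 =
      contract ξ (k + 1) f.1 * contract ξ (l + 1) g.1 :=
  contract_symProduct ξ f.1 g.1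

/-- The bracket of two homogeneous elements of `SHF`. -/
def SHF.bracket {k l : ℕ} (f : SHF Ω k) (g : SHF Ω l) : SHF Ω (k + l) :=
  ⟨(symLieDeriv (hamiltonianFields f) g.1 : TensorFunction N n P (k + (l + 1))),
    (isContractedHamiltonianFor_hamiltonianFields f).symLieDeriv_mem_SHF
      (isContractedHamiltonianFor_hamiltonianFields g)⟩

theorem SHF.bracket_apply_apply {k l : ℕ} (f : SHF Ω k) (g : SHF Ω l)
    {X : TensorVectorField N n P k} (hX : IsHamiltonianFor Ω f.1 X)
    (α : MultiIndex n (k + l + 1)) (x : P) :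
    (SHF.bracket f g).1 α x = bracketComponent X g.1 α x := by
  rw [← symLieDeriv_factorial_smul_apply,
    ((isHamiltonianFor_iff f.2.1).1 hX).symLieDeriv_congr
      (isContractedHamiltonianFor_hamiltonianFields f)
      (isContractedHamiltonianFor_hamiltonianFields g)]
  rfl

theorem SHF.contract_bracket {k l : ℕ} (f : SHF Ω k) (g : SHF Ω l) (ξ : Fin n → ℝ) :
    contract ξ (k + l + 1) (SHF.bracket f g).1 =
      lieDeriv (contract ξ k (hamiltonianFields f)) (contract ξ (l + 1) g.1) :=
  contract_symLieDeriv ξ (hamiltonianFields f) g.1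

theorem SHF.contract_bracket_eq_neg {k l : ℕ} (f : SHF Ω k) (g : SHF Ω l) (ξ : Fin n → ℝ) :
    contract ξ (k + l + 1) (SHF.bracket f g).1 =
      -lieDeriv (contract ξ l (hamiltonianFields g)) (contract ξ (k + 1) f.1) :=
  (SHF.contract_bracket f g ξ).trans <|
    (isContractedHamiltonianFor_hamiltonianFields f ξ).lieDeriv_eq
      (isContractedHamiltonianFor_hamiltonianFields g ξ)

-- Without these two shortcuts, `LinearMap.mk₂` on `SHF Ω k` times out in instance search.
local instance mulActionSHF {k : ℕ} : MulAction ℝ (SHF Ω k) := Module.toDistribMulAction.toMulAction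

local instance smulCommClassSHF {k : ℕ} : SMulCommClass ℝ ℝ (SHF Ω k) := smulCommClass_self ℝ _

variable (Ω) in
/-- `SHF.mul` as a bilinear map. -/
def homogeneousProduct (k l : ℕ) : SHF Ω k →ₗ[ℝ] SHF Ω l →ₗ[ℝ] SHF Ω (k + 1 + l) :=
  LinearMap.mk₂ ℝ SHF.mul
    (fun f f' g => SHF.ext_contract fun ξ => by
      simp only [SHF.contract_mul, Submodule.coe_add, map_add, add_mul])
    (fun c f g => SHF.ext_contract fun ξ => by
      simp only [SHF.contract_mul, Submodule.coe_smul, map_smul, smul_mul_assoc])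
    (fun f g g' => SHF.ext_contract fun ξ => by
      simp only [SHF.contract_mul, Submodule.coe_add, map_add, mul_add])
    (fun c f g => SHF.ext_contract fun ξ => by
      simp only [SHF.contract_mul, Submodule.coe_smul, map_smul, mul_smul_comm])

variable (Ω) in
/-- `SHF.bracket` as a bilinear map. -/
def homogeneousBracket (k l : ℕ) : SHF Ω k →ₗ[ℝ] SHF Ω l →ₗ[ℝ] SHF Ω (k + l) :=
  LinearMap.mk₂ ℝ SHF.bracket
    (fun f f' g => SHF.ext_contract fun ξ => by
      simp only [SHF.contract_bracket_eq_neg, Submodule.coe_add, map_add, neg_add])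
    (fun c f g => SHF.ext_contract fun ξ => by
      simp only [SHF.contract_bracket_eq_neg, Submodule.coe_smul, map_smul, smul_neg])
    (fun f g g' => SHF.ext_contract fun ξ => by
      simp only [SHF.contract_bracket, Submodule.coe_add, map_add])
    (fun c f g => SHF.ext_contract fun ξ => by
      simp only [SHF.contract_bracket, Submodule.coe_smul, map_smul])

/-- The bilinear extension to `SHF` of operations on its homogeneous parts. -/
def bilinearExtension {d : ℕ → ℕ → ℕ}
    (B : ∀ k l, SHF Ω k →ₗ[ℝ] SHF Ω l →ₗ[ℝ] SHF Ω (d k l)) :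
    TotalSHF Ω →ₗ[ℝ] TotalSHF Ω →ₗ[ℝ] TotalSHF Ω :=
  DirectSum.toModule ℝ ℕ _ fun k => LinearMap.flip (DirectSum.toModule ℝ ℕ _ fun l =>
    ((B k l).compr₂ (DirectSum.lof ℝ ℕ (fun k => SHF Ω k) (d k l))).flip)

theorem bilinearExtension_of {d : ℕ → ℕ → ℕ}
    (B : ∀ k l, SHF Ω k →ₗ[ℝ] SHF Ω l →ₗ[ℝ] SHF Ω (d k l)) (k l : ℕ) (f : SHF Ω k)
    (g : SHF Ω l) :
    bilinearExtension B (DirectSum.of (fun k => SHF Ω k) k f)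
        (DirectSum.of (fun k => SHF Ω k) l g) =
      DirectSum.of (fun k => SHF Ω k) (d k l) (B k l f g) := by
  simp only [bilinearExtension, ← DirectSum.lof_eq_of ℝ, DirectSum.toModule_lof,
    LinearMap.flip_apply, LinearMap.compr₂_apply]

variable (Ω) in
/-- The sum over all ranks of the contractions with `ξ`. -/
def totalContract (ξ : Fin n → ℝ) : TotalSHF Ω →ₗ[ℝ] SmoothFunction (𝓡 N) P :=
  DirectSum.toModule ℝ ℕ _ fun k => contract ξ (k + 1) ∘ₗ (SHF Ω k).subtype

theorem totalContract_of (ξ : Fin n → ℝ) (k : ℕ) (f : SHF Ω k) :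
    totalContract Ω ξ (DirectSum.of (fun k => SHF Ω k) k f) = contract ξ (k + 1) f.1 := by
  rw [totalContract, ← DirectSum.lof_eq_of ℝ, DirectSum.toModule_lof]
  rfl

open Classical in
theorem totalContract_smul_covector (t : ℝ) (ξ : Fin n → ℝ) (a : TotalSHF Ω) :
    totalContract Ω (t • ξ) a =
      ∑ k ∈ DFinsupp.support a, t ^ (k + 1) • contract ξ (k + 1) (a k).1 := by
  conv_lhs => rw [← DirectSum.sum_support_of a, map_sum]
  simp only [totalContract_of, contract_smul_covector]

theorem total_eq_zero_of_totalContract {a : TotalSHF Ω} (h : ∀ ξ, totalContract Ω ξ a = 0) :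
    a = 0 := by
  classical
  refine DFinsupp.ext fun k => SHF.ext_contract fun ξ => ?_
  by_cases hk : k ∈ DFinsupp.support a
  · have hzero : contract ξ (k + 1) (a k).1 = 0 :=
      eq_zero_of_forall_sum_pow_smul_eq_zero Nat.succ_injective
        (fun t => (totalContract_smul_covector t ξ a).symm.trans (h (t • ξ))) hk
    exact hzero.trans (map_zero (contract ξ (k + 1))).symm
  · rw [DFinsupp.notMem_support_iff.1 hk]
    rfl

theorem total_ext {a b : TotalSHF Ω} (h : ∀ ξ, totalContract Ω ξ a = totalContract Ω ξ b) :
    a = b :=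
  sub_eq_zero.1 (total_eq_zero_of_totalContract fun ξ => by rw [map_sub, h, sub_self])

variable (Ω) in
/-- The symmetrized tensor product on `SHF`. -/
def totalProduct : TotalSHF Ω →ₗ[ℝ] TotalSHF Ω →ₗ[ℝ] TotalSHF Ω :=
  bilinearExtension (homogeneousProduct Ω)

variable (Ω) in
/-- The bracket on `SHF`. -/
def totalBracket : TotalSHF Ω →ₗ[ℝ] TotalSHF Ω →ₗ[ℝ] TotalSHF Ω :=
  bilinearExtension (homogeneousBracket Ω)

theorem totalContract_totalProduct (ξ : Fin n → ℝ) (a b : TotalSHF Ω) :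
    totalContract Ω ξ (totalProduct Ω a b) = totalContract Ω ξ a * totalContract Ω ξ b := by
  induction a using DirectSum.induction_on with
  | zero => simp only [map_zero, LinearMap.zero_apply, zero_mul]
  | add a a' ha ha' => simp only [map_add, LinearMap.add_apply, ha, ha', add_mul]
  | of k f =>
    induction b using DirectSum.induction_on with
    | zero => simp only [map_zero, mul_zero]
    | add b b' hb hb' => simp only [map_add, hb, hb', mul_add]
    | of l g =>
      rw [totalProduct, bilinearExtension_of, totalContract_of, totalContract_of,
        totalContract_of]
      exact SHF.contract_mul f g ξ

theorem totalContract_totalBracket_of (ξ : Fin n → ℝ) {k : ℕ} (f : SHF Ω k) (b : TotalSHF Ω) :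
    totalContract Ω ξ (totalBracket Ω (DirectSum.of (fun k => SHF Ω k) k f) b) =
      lieDeriv (contract ξ k (hamiltonianFields f)) (totalContract Ω ξ b) := by
  induction b using DirectSum.induction_on with
  | zero => simp only [map_zero]
  | add b b' hb hb' => simp only [map_add, hb, hb']
  | of l g =>
    rw [totalBracket, bilinearExtension_of, totalContract_of, totalContract_of]
    exact SHF.contract_bracket f g ξ

theorem exists_isHamiltonianField_totalContract (ξ : Fin n → ℝ) (a : TotalSHF Ω) :
    ∃ X : SmoothField (𝓡 N) P,
      IsHamiltonianField (Ω.contractedForm ξ) X (totalContract Ω ξ a) ∧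
      ∀ b, totalContract Ω ξ (totalBracket Ω a b) = lieDeriv X (totalContract Ω ξ b) := by
  induction a using DirectSum.induction_on with
  | zero =>
    exact ⟨0, by simpa only [map_zero] using .zero, fun b => by
      simp only [map_zero, LinearMap.zero_apply]⟩
  | add a a' ha ha' =>
    obtain ⟨X, hX, hb⟩ := ha
    obtain ⟨X', hX', hb'⟩ := ha'
    exact ⟨X + X', by simpa only [map_add] using hX.add hX', fun b => by
      simp only [map_add, LinearMap.add_apply, hb, hb']⟩
  | of k f =>
    refine ⟨contract ξ k (hamiltonianFields f), ?_, totalContract_totalBracket_of ξ f⟩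
    rw [totalContract_of]
    exact isContractedHamiltonianFor_hamiltonianFields f ξ

theorem isPoissonAlgebra_total :
    IsPoissonAlgebra (A := TotalSHF Ω) (totalProduct Ω) (totalBracket Ω) where
  mul_comm a b := total_ext fun ξ => by simp only [totalContract_totalProduct, mul_comm]
  mul_assoc a b c := total_ext fun ξ => by simp only [totalContract_totalProduct, mul_assoc]
  bracket_self a := total_ext fun ξ => by
    obtain ⟨X, hX, ha⟩ := exists_isHamiltonianField_totalContract ξ a
    rw [ha, hX.lieDeriv_self, map_zero]
  bracket_antisymm a b := total_ext fun ξ => by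
    obtain ⟨X, hX, ha⟩ := exists_isHamiltonianField_totalContract ξ a
    obtain ⟨Y, hY, hb⟩ := exists_isHamiltonianField_totalContract ξ b
    rw [map_neg, ha, hb, hX.lieDeriv_eq hY]
  jacobi a b c := total_ext fun ξ => by
    obtain ⟨X, hX, ha⟩ := exists_isHamiltonianField_totalContract ξ a
    obtain ⟨Y, hY, hb⟩ := exists_isHamiltonianField_totalContract ξ b
    obtain ⟨Z, hZ, hc⟩ := exists_isHamiltonianField_totalContract ξ c
    simpa only [map_add, map_zero, ha, hb, hc] using
      hX.jacobi (Ω.contractedForm_mem_closedForms ξ) hY hZ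
  leibniz a b c := total_ext fun ξ => by
    obtain ⟨X, -, ha⟩ := exists_isHamiltonianField_totalContract ξ a
    simp only [map_add, totalContract_totalProduct, ha, lieDeriv_mul]

end TotalSpace
end NSymplectic
end

open NSymplectic in
theorem mainTheorem9 (N n : ℕ) (P : Type*) [TopologicalSpace P]
    [ChartedSpace (EuclideanSpace ℝ (Fin N)) P] [IsManifold (𝓡 N) ∞ P]
    (Ω : GeneralNSymplecticStructure N n P) :
    ∃ mul br : TotalSHF Ω →ₗ[ℝ] TotalSHF Ω →ₗ[ℝ] TotalSHF Ω,
      (∀ (k l : ℕ) (f : SHF Ω k) (g : SHF Ω l),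
        ∃ h : SHF Ω (k + 1 + l),
          (h : TensorFunction N n P (k + 1 + l + 1)) =
            symProduct (f : TensorFunction N n P (k + 1)) (g : TensorFunction N n P (l + 1)) ∧
          mul (DirectSum.of (fun k => SHF Ω k) k f) (DirectSum.of (fun k => SHF Ω k) l g) =
            DirectSum.of (fun k => SHF Ω k) (k + 1 + l) h) ∧
      (∀ (k l : ℕ) (f : SHF Ω k) (g : SHF Ω l),
        ∃ h : SHF Ω (k + l),
          (∀ X : TensorVectorField N n P k,
            IsHamiltonianFor Ω (f : TensorFunction N n P (k + 1)) X →
              ∀ (α : MultiIndex n (k + l + 1)) (x : P),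
                (h : TensorFunction N n P (k + l + 1)) α x =
                  bracketComponent X (g : TensorFunction N n P (l + 1)) α x) ∧
          br (DirectSum.of (fun k => SHF Ω k) k f) (DirectSum.of (fun k => SHF Ω k) l g) =
            DirectSum.of (fun k => SHF Ω k) (k + l) h) ∧
      IsPoissonAlgebra (A := TotalSHF Ω) mul br := by
  refine ⟨totalProduct Ω, totalBracket Ω,
    fun k l f g => ⟨SHF.mul f g, rfl, bilinearExtension_of _ k l f g⟩,
    fun k l f g => ⟨SHF.bracket f g, fun X hX => SHF.bracket_apply_apply f g hX,
      bilinearExtension_of _ k l f g⟩,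
    isPoissonAlgebra_total⟩
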